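/- Let $\mathcal S,\mathcal A$ be finite nonempty sets, and consider the discounted Markov decision process with transition probabilities $P(s'\mid s,a)$, real rewards $r(s,a,s')$ and discount factor $\gamma\in(0,1)$. Write $n=|\mathcal S||\mathcal A|$ and identify functions on $\mathcal S\times\mathcal A$ with vectors in $\mathbb R^n$. For a deterministic policy $\pi:\mathcal S\to\mathcal A$ let $Q^\pi(s,a)=\mathbb E\big[\sum_{k\ge0}\gamma^k r(s_k,a_k,s_{k+1})\mid s_0=s,a_0=a,\pi\big]$, let $Q^*=\max_\pi Q^\pi$ (pointwise), and let $\Theta^*$ be the set of deterministic policies $\pi$ with $\pi(s)\in\operatorname{Argmax}_a Q^*(s,a)$ for all $s$. Let $p$ be a distribution on $\mathcal S$ and $b(\cdot\mid s)$ a behavior policy with $d(s,a):=p(s)b(a\mid s)>0$ for all $(s,a)$; let $\alpha\in(0,1)$, and let $Q_0\in\mathbb R^n$ be deterministic. Let $(s_k,a_k,s_k')_{k\ge0}$ be i.i.d. with $\mathbb P(s_k=s,a_k=a,s_k'=s')=p(s)\,b(a\mid s)\,P(s'\mid s,a)$, and let $Q_{k+1}$ be obtained from $Q_k$ by changing only the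 coordinate $(s_k,a_k)$: $$Q_{k+1}(s_k,a_k)=Q_k(s_k,a_k)+\alpha\Big(r(s_k,a_k,s_k')+\gamma\max_{u\in\mathcal A}Q_k(s_k',u)-Q_k(s_k,a_k)\Big).$$ Put $e_k:=Q_k-Q^*$, and let $x^-$ be the componentwise negative part, $x^-_i=\max\{-x_i,0\}$. Let $R_{\max}=\max|r|$ and $$W_{\max}=\big(1+\sqrt{|\mathcal S||\mathcal A|}\big)^2\Big(R_{\max}+(1+\gamma)\max\big\{\|Q_0\|_\infty,\tfrac{R_{\max}}{1-\gamma}\big\}\Big)^2 .$$ For a deterministic policy $\pi$ let $\mathbf A_\pi=I-\alpha D+\alpha\gamma DP\boldsymbol\Pi^\pi$, where $D=\operatorname{diag}(d(s,a))$, $P$ is the $n\times|\mathcal S|$ transition matrix, and $(\boldsymbol\Pi^\pi Q)(s)=Q(s,\pi(s))$. A minimizer $\pi_-^\star\in\operatorname{Argmin}_{\pi\in\Theta^*}\rho(\mathbf A_\pi)$ of the spectral radius exists; let $\pi_-^\star$ be any such minimizer, $\mathbf A_-^\star=\mathbf A_{\pi_-^\star}$ and $\rho_-^\star=\rho(\mathbf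 A_-^\star)=\min_{\pi\in\Theta^*}\rho(\mathbf A_\pi)$. Then $\rho_-^\star<1$. Let $\varepsilon>0$ with $\beta_-:=\rho_-^\star+\varepsilon<1$, and let $v_-^\star(x)=\sum_{t\ge0}\beta_-^{-2t}\|(\mathbf A_-^\star)^tx\|_2^2$. Then there is a constant $C\ge1$ such that, for all $x\in\mathbb R^n$, this series converges and $\|x\|_2^2\le v_-^\star(x)\le C\|x\|_2^2$; and for every such constant $C=C_-^\star$ and every $k\ge0$, $$\mathbb E\big[\operatorname{dist}_\infty(e_k,\mathbb R_+^{n})\big]\le\sqrt{C_-^\star}\,\beta_-^k\,\|e_0^-\|_2+\alpha\,C_-^\star\sqrt{\frac{W_{\max}}{1-\beta_-^2}},$$ where $\operatorname{dist}_\infty$ is the distance in the sup norm and $\mathbb R^n_+=\{x\ge0\}$. Consequently, for every such $\varepsilon$, the part of $\mathbb E[\operatorname{dist}_\infty(e_k,\mathbb R_+^{n})]$ that exceeds the noise floor $\alpha\,C_-^\star\sqrt{W_{\max}/(1-\beta_-^2)}$ is $O\big((\rho_-^\star+\varepsilon)^k\big)$ as $k\to\infty$. (The noise floor carries an explicit factor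 $\alpha$; $W_{\max}$ does not depend on $\alpha$, while $C_-^\star$ and $\beta_-$ may.) -/

import Mathlib

open MeasureTheory ProbabilityTheory Filter Topology Asymptotics

noncomputable section

/-- A finite discounted Markov decision process with state space `S` and action space `A`:
transition law `P (· | s, a)`, one-step reward `r (s, a, s')`, discount factor `γ ∈ (0,1)`. -/
structure DiscountedMDP (S A : Type*) where
  P : S → A → PMF S
  r : S → A → S → ℝ
  γ : ℝ
  γ_pos : 0 < γ
  γ_lt_one : γ < 1

namespace DiscountedMDP

variable {S A : Type*} [Fintype S] [Fintype A]

section Value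

variable [MeasurableSpace S] [MeasurableSpace A] [MeasurableSingletonClass S]
  [MeasurableSingletonClass A]

/-- Transition kernel of the state-action pair under the deterministic policy `π`:
from `(s, a)` move to `(s', π s')` with `s' ~ P (· | s, a)`. -/
def pairKernel (M : DiscountedMDP S A) (π : S → A) : Kernel (S × A) (S × A) :=
  Kernel.ofFunOfCountable fun x => ((M.P x.1 x.2).map fun s' => (s', π s')).toMeasure

instance (M : DiscountedMDP S A) (π : S → A) : IsMarkovKernel (M.pairKernel π) :=
  ⟨fun _ => PMF.toMeasure.isProbabilityMeasure _⟩

/-- The kernel giving the pair at time `n + 1` from the history up to time `n`; it only uses the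
pair at time `n`. -/
def historyKernel (M : DiscountedMDP S A) (π : S → A) (n : ℕ) :
    Kernel ((_i : Finset.Iic n) → S × A) (S × A) :=
  (M.pairKernel π).comap (fun h => h ⟨n, Finset.mem_Iic.2 le_rfl⟩) (measurable_pi_apply _)

instance (M : DiscountedMDP S A) (π : S → A) (n : ℕ) : IsMarkovKernel (M.historyKernel π n) :=
  Kernel.IsMarkovKernel.comap _ _

/-- Law of the trajectory `(s_k, a_k)_{k ≥ 0}` started from `(s_0, a_0) = x` and following `π`
from time `1` on. -/
def trajLaw (M : DiscountedMDP S A) (π : S → A) (x : S × A) : Measure (ℕ → S × A) :=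
  Kernel.traj (X := fun _ => S × A) (M.historyKernel π) 0 (fun _ => x)

/-- `Q^π (s, a) = E [∑_k γ^k r (s_k, a_k, s_{k+1}) | s_0 = s, a_0 = a, π]`. -/
def policyQ (M : DiscountedMDP S A) (π : S → A) (x : S × A) : ℝ :=
  ∫ ω, ∑' k : ℕ, M.γ ^ k * M.r (ω k).1 (ω k).2 (ω (k + 1)).1 ∂(M.trajLaw π x)

/-- The optimal Q-function: supremum of `Q^π` over all deterministic policies. -/
def optQ (M : DiscountedMDP S A) (x : S × A) : ℝ :=
  ⨆ π : S → A, M.policyQ π x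

/-- The set `Θ*` of policies that pick a maximizer of `Q* (s, ·)` in every state. -/
def optPolicies (M : DiscountedMDP S A) : Set (S → A) :=
  {π | ∀ s a, M.optQ (s, a) ≤ M.optQ (s, π s)}

end Value

/-- Bound on the rewards, `R_max = max |r (s, a, s')|`. -/
def rewardMax (M : DiscountedMDP S A) : ℝ :=
  ⨆ x : S × A × S, |M.r x.1 x.2.1 x.2.2|

/-- The constant `W_max`; `‖Q₀‖` is the sup norm. -/
def noiseMax (M : DiscountedMDP S A) (Q₀ : S × A → ℝ) : ℝ :=
  (1 + √((Fintype.card S : ℝ) * Fintype.card A)) ^ 2 *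
    (M.rewardMax + (1 + M.γ) * max ‖Q₀‖ (M.rewardMax / (1 - M.γ))) ^ 2

/-- The matrix `P` of size `|S||A| × |S|`. -/
def transMatrix (M : DiscountedMDP S A) : Matrix (S × A) S ℝ :=
  Matrix.of fun x s' => (M.P x.1 x.2 s').toReal

variable [DecidableEq S] [DecidableEq A]

/-- `A_π = I - α D + α γ D P Π^π`, where `D` is the diagonal matrix of the sampling probabilities
`d` and `Π^π` has the row `e_{s, π(s)}` at `s`. -/
def modeMatrix (M : DiscountedMDP S A) (d : S × A → ℝ) (α : ℝ) (π : S → A) :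
    Matrix (S × A) (S × A) ℝ :=
  1 - α • Matrix.diagonal d + (α * M.γ) •
    (Matrix.diagonal d * M.transMatrix *
      Matrix.of fun (s : S) (x : S × A) => if x = (s, π s) then (1 : ℝ) else 0)

/-- Asynchronous Q-learning with step size `α` from the table `Q₀`, along the observations
`o k = (s_k, a_k, s'_k)`. -/
def qIter (M : DiscountedMDP S A) (α : ℝ) (Q₀ : S × A → ℝ) (o : ℕ → S × A × S) :
    ℕ → S × A → ℝ
  | 0 => Q₀
  | k + 1 =>
    let Q := qIter M α Q₀ o k
    let s := (o k).1
    let a := (o k).2.1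
    let s' := (o k).2.2
    Function.update Q (s, a) (Q (s, a) + α * (M.r s a s' + M.γ * (⨆ u, Q (s', u)) - Q (s, a)))

end DiscountedMDP

/-- The sampling probabilities `d (s, a) = p (s) b (a | s)`. -/
def samplingProb {S A : Type*} (p : PMF S) (b : S → PMF A) (x : S × A) : ℝ :=
  (p x.1 * b x.1 x.2).toReal

/-- The i.i.d. observation model: the triples `(s_k, a_k, s'_k)` are independent over `k`, with
`s_k ~ p`, `a_k ~ b (· | s_k)`, `s'_k ~ P (· | s_k, a_k)`. -/
structure IsIIDObservation {S A Ω : Type*} [MeasurableSpace S] [MeasurableSpace A]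
    [MeasurableSpace Ω] (M : DiscountedMDP S A) (p : PMF S) (b : S → PMF A) (μ : Measure Ω)
    (obs : ℕ → Ω → S × A × S) : Prop where
  measurable : ∀ k, Measurable (obs k)
  indep : iIndepFun obs μ
  law : ∀ k s a s', μ {ω | obs k ω = (s, a, s')} = p s * b s a * M.P s a s'

/-- The spectral radius of a real square matrix (largest modulus of a complex eigenvalue). -/
def specRadius {n : Type*} [Fintype n] [DecidableEq n] (B : Matrix n n ℝ) : ℝ :=
  (spectralRadius ℂ (B.map (algebraMap ℝ ℂ))).toReal

/-- The Euclidean norm of a vector. -/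
def l2norm {n : Type*} [Fintype n] (x : n → ℝ) : ℝ :=
  ‖(WithLp.toLp 2 x : EuclideanSpace ℝ n)‖

/-- The summand `β^{-2t} ‖B^t x‖₂²` of the fixed-mode Lyapunov function. -/
def lyapTerm {n : Type*} [Fintype n] [DecidableEq n] (B : Matrix n n ℝ) (β : ℝ) (x : n → ℝ)
    (t : ℕ) : ℝ :=
  (β ^ (2 * t))⁻¹ * l2norm ((B ^ t).mulVec x) ^ 2

/-- The fixed-mode Lyapunov function `v (x) = ∑_t β^{-2t} ‖B^t x‖₂²`. -/
def lyap {n : Type*} [Fintype n] [DecidableEq n] (B : Matrix n n ℝ) (β : ℝ) (x : n → ℝ) : ℝ :=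
  ∑' t, lyapTerm B β x t

/-- `C ≥ 1` is a norm-equivalence constant of the Lyapunov function:
`‖x‖₂² ≤ v (x) ≤ C ‖x‖₂²` for all `x`, the series defining `v (x)` being convergent. -/
def IsNormEquivConst {n : Type*} [Fintype n] [DecidableEq n] (B : Matrix n n ℝ) (β C : ℝ) :
    Prop :=
  1 ≤ C ∧ ∀ x, Summable (lyapTerm B β x) ∧
    l2norm x ^ 2 ≤ lyap B β x ∧ lyap B β x ≤ C * l2norm x ^ 2

section Rate

variable {S A : Type*} [Fintype S] [Fintype A] [DecidableEq S] [DecidableEq A]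
  [MeasurableSpace S] [MeasurableSpace A] [MeasurableSingletonClass S]
  [MeasurableSingletonClass A]

/-- The optimal policies `π` whose mode matrix `A_π` has the smallest spectral radius among all
optimal policies. -/
def IsOptimizedPolicy (M : DiscountedMDP S A) (d : S × A → ℝ) (α : ℝ) (π : S → A) : Prop :=
  π ∈ M.optPolicies ∧
    ∀ π' ∈ M.optPolicies, specRadius (M.modeMatrix d α π) ≤ specRadius (M.modeMatrix d α π')

/-- `dist_∞ (e_k, ℝ_+^{|S||A|})` with `e_k = Q_k - Q*`; functions `S × A → ℝ` carry the
sup-norm distance. -/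
def orthantDist (M : DiscountedMDP S A) (α : ℝ) (Q₀ : S × A → ℝ) (k : ℕ) (o : ℕ → S × A × S) :
    ℝ :=
  Metric.infDist (M.qIter α Q₀ o k - M.optQ) {y : S × A → ℝ | 0 ≤ y}

end Rate

end

noncomputable section

/-! The error is bounded below by a linear system. Fix `π ∈ Θ*`. The maximum over actions is at
least the value at `π`, and `Q*` is a subsolution of the Bellman equation of `π` (`optQ_le`), so
`e_{k+1} ≥ A_π e_k + α w_k`, where `w_k` is the centered noise. Since `A_π` is entrywise
nonnegative, the system `y_{k+1} = A_π y_k + α w_k` started at `y_0 = -e_0^-` stays below `e_k`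
(`lowerIter_le`), and the distance of `e_k` to the orthant is at most `‖y_k‖₂` (`orthantDist_le`).

It remains to bound `E‖y_k‖₂²`. The table `Q_k` and `y_k` depend only on observations before time
`k`, so `w_k` has conditional mean zero and the cross term vanishes: `E‖A^t y_{k+1}‖² ≤ E‖A^{t+1}
y_k‖² + α² sup ‖A^t w‖²`. Each term of the Lyapunov series gives `‖A^t x‖² ≤ C β^{2t} ‖x‖²`, so
unrolling the recursion leaves `C β^{2k} ‖y_0‖²` plus a geometric sum of noise
(`integral_l2norm_pow_lowerIter_le`). Jensen's inequality passes to the first moment. A finite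
constant `C` exists by Gelfand's formula (`exists_isNormEquivConst`). -/

theorem PMF.sum_toReal {ι : Type*} [Fintype ι] (p : PMF ι) : ∑ i, (p i).toReal = 1 := by
  rw [← ENNReal.toReal_sum fun i _ => p.apply_ne_top i, ← tsum_fintype (L := .unconditional _),
    p.tsum_coe, ENNReal.toReal_one]

/-! ### Value functions: from trajectory laws to the Bellman inequality for `Q*`. -/

namespace DiscountedMDP

section Value

variable {S A : Type*}

theorem rewardMax_nonneg (M : DiscountedMDP S A) : 0 ≤ M.rewardMax :=
  Real.iSup_nonneg fun _ => abs_nonneg _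

variable [Fintype S]

/-- Averaging over the next state: `(s, a) ↦ ∑ s', P (s' | s, a) f (s')`. -/
def stepMean (M : DiscountedMDP S A) (f : S → ℝ) (x : S × A) : ℝ :=
  ∑ s', (M.P x.1 x.2 s').toReal * f s'

theorem sum_trans_toReal (M : DiscountedMDP S A) (x : S × A) :
    ∑ s', (M.P x.1 x.2 s').toReal = 1 :=
  (M.P x.1 x.2).sum_toReal

theorem stepMean_mono (M : DiscountedMDP S A) {f g : S → ℝ} (h : ∀ s, f s ≤ g s) (x : S × A) :
    M.stepMean f x ≤ M.stepMean g x :=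
  Finset.sum_le_sum fun s _ => mul_le_mul_of_nonneg_left (h s) ENNReal.toReal_nonneg

theorem stepMean_const (M : DiscountedMDP S A) (c : ℝ) (x : S × A) :
    M.stepMean (fun _ => c) x = c := by
  rw [stepMean, ← Finset.sum_mul, M.sum_trans_toReal, one_mul]

theorem stepMean_add (M : DiscountedMDP S A) (f g : S → ℝ) (x : S × A) :
    M.stepMean (fun s => f s + g s) x = M.stepMean f x + M.stepMean g x := by
  simp [stepMean, mul_add, Finset.sum_add_distrib]

theorem stepMean_sub (M : DiscountedMDP S A) (f g : S → ℝ) (x : S × A) :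
    M.stepMean (fun s => f s - g s) x = M.stepMean f x - M.stepMean g x := by
  simp [stepMean, mul_sub, Finset.sum_sub_distrib]

theorem stepMean_const_mul (M : DiscountedMDP S A) (c : ℝ) (f : S → ℝ) (x : S × A) :
    M.stepMean (fun s => c * f s) x = c * M.stepMean f x := by
  simp [stepMean, Finset.mul_sum, mul_left_comm]

theorem abs_stepMean_le (M : DiscountedMDP S A) {f : S → ℝ} {c : ℝ} (h : ∀ s, |f s| ≤ c)
    (x : S × A) : |M.stepMean f x| ≤ c := by
  have h1 := M.stepMean_mono (fun s => (abs_le.1 (h s)).1) x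
  have h2 := M.stepMean_mono (fun s => (abs_le.1 (h s)).2) x
  rw [M.stepMean_const] at h1 h2
  exact abs_le.2 ⟨h1, h2⟩

/-- The transition operator of the state-action chain under the policy `π`. -/
def pairMean (M : DiscountedMDP S A) (π : S → A) (g : S × A → ℝ) (x : S × A) : ℝ :=
  M.stepMean (fun s => g (s, π s)) x

/-- The expected one-step reward. -/
def meanReward (M : DiscountedMDP S A) (x : S × A) : ℝ :=
  M.stepMean (M.r x.1 x.2) x

theorem abs_reward_le [Fintype A] (M : DiscountedMDP S A) (s : S) (a : A) (s' : S) :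
    |M.r s a s'| ≤ M.rewardMax :=
  le_ciSup (f := fun x : S × A × S => |M.r x.1 x.2.1 x.2.2|) (Set.finite_range _).bddAbove
    (s, a, s')

variable [Fintype A] [MeasurableSpace S] [MeasurableSpace A] [MeasurableSingletonClass S]
  [MeasurableSingletonClass A]

theorem integral_pairKernel (M : DiscountedMDP S A) (π : S → A) (g : S × A → ℝ) (x : S × A) :
    ∫ y, g y ∂(M.pairKernel π x) = M.pairMean π g x := by
  change ∫ y, g y ∂((M.P x.1 x.2).map fun s' => (s', π s')).toMeasure = _
  have hm : Measurable fun s' => (s', π s') := measurable_of_countable _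
  rw [← PMF.toMeasure_map _ _ hm,
    integral_map hm.aemeasurable (measurable_of_countable g).aestronglyMeasurable,
    PMF.integral_eq_sum]
  simp [pairMean, stepMean]

instance (M : DiscountedMDP S A) (π : S → A) (x : S × A) :
    IsProbabilityMeasure (M.trajLaw π x) := by
  unfold trajLaw; infer_instance

/-- The Markov property. The joint law of the history up to `k` and the next pair is the
composition-product with `historyKernel`, which reads only the last pair of the history. -/
theorem integral_trajLaw_succ (M : DiscountedMDP S A) (π : S → A) (x : S × A)
    (f : S × A → S × A → ℝ) (k : ℕ) :
    ∫ ω, f (ω k) (ω (k + 1)) ∂(M.trajLaw π x)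
      = ∫ ω, M.pairMean π (f (ω k)) (ω k) ∂(M.trajLaw π x) := by
  have key := Kernel.partialTraj_compProd_eq_map_traj (X := fun _ => S × A)
    (κ := M.historyKernel π) (a := 0) (b := k) (Nat.zero_le k) (x₀ := fun _ => x)
  have hfst := Kernel.traj_map_frestrictLe_apply (X := fun _ => S × A)
    (κ := M.historyKernel π) 0 k (fun _ => x)
  let F : ((_i : Finset.Iic k) → S × A) × (S × A) → ℝ :=
    fun z => f (z.1 ⟨k, Finset.mem_Iic.2 le_rfl⟩) z.2
  have hF : Measurable F := measurable_of_countable _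
  have h1 : ∫ ω, f (ω k) (ω (k + 1)) ∂(M.trajLaw π x)
      = ∫ z, F z ∂((M.trajLaw π x).map fun ω => (Preorder.frestrictLe k ω, ω (k + 1))) := by
    rw [integral_map (by fun_prop) hF.aestronglyMeasurable]
    rfl
  have h2 : ∫ ω, M.pairMean π (f (ω k)) (ω k) ∂(M.trajLaw π x)
      = ∫ h, M.pairMean π (f (h ⟨k, Finset.mem_Iic.2 le_rfl⟩)) (h ⟨k, Finset.mem_Iic.2 le_rfl⟩)
        ∂((M.trajLaw π x).map (Preorder.frestrictLe (π := fun _ => S × A) k)) := by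
    rw [integral_map (by fun_prop) (measurable_of_countable _).aestronglyMeasurable]
    rfl
  rw [h1, h2]
  unfold trajLaw
  rw [← key, hfst, Measure.integral_compProd (Integrable.of_finite)]
  refine integral_congr_ae (ae_of_all _ fun h => ?_)
  exact M.integral_pairKernel π _ _

theorem integral_trajLaw_apply (M : DiscountedMDP S A) (π : S → A) (x : S × A) (g : S × A → ℝ)
    (k : ℕ) : ∫ ω, g (ω k) ∂(M.trajLaw π x) = (M.pairMean π)^[k] g x := by
  induction k generalizing g with
  | zero =>
    have hfst := Kernel.traj_map_frestrictLe_apply (X := fun _ => S × A)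
      (κ := M.historyKernel π) 0 0 (fun _ => x)
    have h2 : ∫ ω, g (ω 0) ∂(M.trajLaw π x)
        = ∫ h, g (h ⟨0, Finset.mem_Iic.2 le_rfl⟩)
          ∂((M.trajLaw π x).map (Preorder.frestrictLe (π := fun _ => S × A) 0)) := by
      rw [integral_map (by fun_prop) (measurable_of_countable _).aestronglyMeasurable]
      rfl
    rw [h2]
    unfold trajLaw
    rw [hfst, Kernel.partialTraj_self, Kernel.id_apply, integral_dirac]
    rfl
  | succ k ih =>
    rw [M.integral_trajLaw_succ π x (fun _ => g) k, ih, Function.iterate_succ_apply]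

/-- Domination by `γ^k R_max` allows exchanging sum and expectation, and the Markov property
evaluates each term. From here on no trajectory measure is needed. -/
theorem hasSum_policyQ (M : DiscountedMDP S A) (π : S → A) (x : S × A) :
    HasSum (fun k => M.γ ^ k * (M.pairMean π)^[k] M.meanReward x) (M.policyQ π x) := by
  have hint : ∀ k : ℕ, ∫ ω, M.γ ^ k * M.r (ω k).1 (ω k).2 (ω (k + 1)).1 ∂(M.trajLaw π x)
      = M.γ ^ k * (M.pairMean π)^[k] M.meanReward x := fun k => by
    rw [integral_const_mul, M.integral_trajLaw_succ π x (fun y z => M.r y.1 y.2 z.1) k]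
    exact congrArg _ (M.integral_trajLaw_apply π x M.meanReward k)
  have hb : ∀ (k : ℕ) (ω : ℕ → S × A),
      ‖M.γ ^ k * M.r (ω k).1 (ω k).2 (ω (k + 1)).1‖ ≤ M.γ ^ k * M.rewardMax := fun k ω => by
    rw [norm_mul, norm_pow, Real.norm_of_nonneg M.γ_pos.le]
    exact mul_le_mul_of_nonneg_left (M.abs_reward_le _ _ _) (pow_nonneg M.γ_pos.le k)
  have hmeas : ∀ k : ℕ, Measurable fun ω : ℕ → S × A =>
      M.γ ^ k * M.r (ω k).1 (ω k).2 (ω (k + 1)).1 := fun k => by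
    have : Measurable fun z : (S × A) × (S × A) => M.γ ^ k * M.r z.1.1 z.1.2 z.2.1 :=
      measurable_of_countable _
    exact this.comp (g := fun z : (S × A) × (S × A) => M.γ ^ k * M.r z.1.1 z.1.2 z.2.1)
      (f := fun ω : ℕ → S × A => (ω k, ω (k + 1))) (by fun_prop)
  have hI : ∀ k : ℕ, Integrable (fun ω : ℕ → S × A =>
      M.γ ^ k * M.r (ω k).1 (ω k).2 (ω (k + 1)).1) (M.trajLaw π x) := fun k =>
    Integrable.of_bound (hmeas k).aestronglyMeasurable _ (ae_of_all _ (hb k))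
  have := hasSum_integral_of_summable_integral_norm hI <|
    Summable.of_nonneg_of_le (fun k => integral_nonneg fun _ => norm_nonneg _)
      (fun k => (integral_mono (hI k).norm (integrable_const _) (hb k)).trans_eq (by simp))
      ((summable_geometric_of_lt_one M.γ_pos.le M.γ_lt_one).mul_right M.rewardMax)
  simp_rw [hint] at this
  exact this

/-- The Bellman equation of a deterministic policy. -/
theorem policyQ_eq (M : DiscountedMDP S A) (π : S → A) (x : S × A) :
    M.policyQ π x = M.meanReward x + M.γ * M.stepMean (fun s' => M.policyQ π (s', π s')) x := by
  have hs : ∀ k, ∑ s', (M.P x.1 x.2 s').toReal *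
      (M.γ ^ k * (M.pairMean π)^[k] M.meanReward (s', π s'))
        = M.γ ^ k * (M.pairMean π)^[k + 1] M.meanReward x := fun k => by
    rw [Function.iterate_succ_apply', pairMean, stepMean, Finset.mul_sum]
    exact Finset.sum_congr rfl fun s' _ => mul_left_comm _ _ _
  have h1 : HasSum (fun k => M.γ ^ k * (M.pairMean π)^[k + 1] M.meanReward x)
      (M.stepMean (fun s' => M.policyQ π (s', π s')) x) := by
    have := hasSum_sum (s := Finset.univ) fun s' _ =>
      (M.hasSum_policyQ π (s', π s')).mul_left (M.P x.1 x.2 s').toReal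
    simp_rw [hs] at this
    exact this
  have h2 : HasSum (fun k => M.γ ^ (k + 1) * (M.pairMean π)^[k + 1] M.meanReward x)
      (M.γ * M.stepMean (fun s' => M.policyQ π (s', π s')) x) := by
    have := h1.mul_left M.γ
    simp_rw [← mul_assoc, ← pow_succ'] at this
    exact this
  have h3 := (hasSum_nat_add_iff (f := fun k => M.γ ^ k * (M.pairMean π)^[k] M.meanReward x) 1).1 h2
  rw [(M.hasSum_policyQ π x).unique h3, Finset.sum_range_one, add_comm]
  simp

theorem policyQ_le_optQ (M : DiscountedMDP S A) (π : S → A) (x : S × A) :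
    M.policyQ π x ≤ M.optQ x :=
  le_ciSup (f := fun π => M.policyQ π x) (Set.finite_range _).bddAbove π

/-- `Q*` is a subsolution of the Bellman equation of every policy in `Θ*`. -/
theorem optQ_le (M : DiscountedMDP S A) {π : S → A} (hπ : π ∈ M.optPolicies) (x : S × A) :
    M.optQ x ≤ M.meanReward x + M.γ * M.stepMean (fun s' => M.optQ (s', π s')) x := by
  have : Nonempty (S → A) := ⟨π⟩
  refine ciSup_le fun π' => ?_
  rw [M.policyQ_eq π' x]
  gcongr
  · exact M.γ_pos.le
  -- `Q^{π'} ≤ Q*` pointwise, and `π` maximizes `Q*(s, ·)`. Only this inequality is used later, so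
  -- the optimality equation for `Q*` is not required.
  · exact M.stepMean_mono (fun s => (M.policyQ_le_optQ π' _).trans (hπ s (π' s))) x

theorem optPolicies_nonempty [Nonempty A] (M : DiscountedMDP S A) : M.optPolicies.Nonempty := by
  choose π hπ using fun s => Finite.exists_max fun a => M.optQ (s, a)
  exact ⟨π, hπ⟩

end Value

end DiscountedMDP

/-! ### The Euclidean norm on functions. -/

section Euclidean

variable {n : Type*} [Fintype n]

theorem l2norm_nonneg (x : n → ℝ) : 0 ≤ l2norm x := norm_nonneg _

theorem l2norm_sq (x : n → ℝ) : l2norm x ^ 2 = ∑ i, x i ^ 2 := by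
  simp [l2norm, EuclideanSpace.norm_sq_eq]

theorem abs_apply_le_l2norm (x : n → ℝ) (i : n) : |x i| ≤ l2norm x :=
  PiLp.norm_apply_le (p := 2) (WithLp.toLp 2 x : EuclideanSpace ℝ n) i

theorem l2norm_sub_le (x y : n → ℝ) : l2norm (x - y) ≤ l2norm x + l2norm y :=
  norm_sub_le (WithLp.toLp 2 x : EuclideanSpace ℝ n) (WithLp.toLp 2 y)

theorem l2norm_neg (x : n → ℝ) : l2norm (-x) = l2norm x :=
  norm_neg (WithLp.toLp 2 x : EuclideanSpace ℝ n)

theorem l2norm_le_sum_abs (x : n → ℝ) : l2norm x ≤ ∑ i, |x i| := by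
  refine abs_le_of_sq_le_sq' ?_ (Finset.sum_nonneg fun _ _ => abs_nonneg _) |>.2
  rw [l2norm_sq]
  simpa using Finset.sum_sq_le_sq_sum_of_nonneg (s := Finset.univ) (f := fun i => |x i|)
    fun _ _ => abs_nonneg _

theorem l2norm_single [DecidableEq n] (i : n) (c : ℝ) : l2norm (Pi.single i c) = |c| :=
  PiLp.norm_single 2 (fun _ => ℝ) i c

end Euclidean

/-! ### Spectral radius, growth of matrix powers and the Lyapunov function. -/

section SpectralRadius

variable {n : Type*} [Fintype n] [DecidableEq n]

section

open scoped Matrix.Norms.Operator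

/-- The spectral radius is at most the sup-norm operator norm, which is the largest absolute row
sum. -/
theorem specRadius_lt_one_of_sum_lt_one [Nonempty n] {B : Matrix n n ℝ} (h0 : ∀ i j, 0 ≤ B i j)
    (h1 : ∀ i, ∑ j, B i j < 1) : specRadius B < 1 := by
  have hn : ‖B.map (algebraMap ℝ ℂ)‖₊ < 1 := by
    rw [Matrix.linfty_opNNNorm_def, Finset.sup_lt_iff (by simp)]
    intro i _
    rw [← NNReal.coe_lt_coe]
    simpa [Real.norm_of_nonneg (h0 i _)] using h1 i
  have := (spectrum.spectralRadius_le_nnnorm (𝕜 := ℂ) (B.map (algebraMap ℝ ℂ))).trans_lt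
    (ENNReal.coe_lt_one_iff.2 hn)
  exact (ENNReal.toReal_lt_toReal this.ne_top ENNReal.one_ne_top).2 this

end

section

open scoped Matrix.Norms.L2Operator

theorem l2norm_mulVec_le (B : Matrix n n ℝ) (x : n → ℝ) :
    l2norm (B.mulVec x) ≤ ‖B.map (algebraMap ℝ ℂ)‖ * l2norm x := by
  have h (y : n → ℝ) : l2norm y = ‖(WithLp.toLp 2 fun i => (y i : ℂ) : EuclideanSpace ℂ n)‖ := by
    simp [l2norm, EuclideanSpace.norm_eq]
  have := (B.map (algebraMap ℝ ℂ)).l2_opNorm_mulVec (WithLp.toLp 2 fun i => (x i : ℂ))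
  rw [h, h]
  refine le_of_eq_of_le (congrArg norm ?_) this
  ext i
  simp [Matrix.mulVec, dotProduct]

/-- Gelfand's formula gives `‖a^t‖ ≤ c^t` for large `t`; the constant `K` absorbs the finitely many
remaining powers. -/
theorem exists_norm_pow_le {a : Matrix n n ℂ} {c : ℝ} (hc : spectralRadius ℂ a < ENNReal.ofReal c) :
    ∃ K, 0 ≤ K ∧ ∀ t : ℕ, ‖a ^ t‖ ≤ K * c ^ t := by
  have hc0 : 0 < c := ENNReal.ofReal_pos.1 (pos_of_gt hc)
  have hev := (spectrum.pow_norm_pow_one_div_tendsto_nhds_spectralRadius a).eventually_lt_const hc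
  have hbig : (fun t : ℕ => a ^ t) =O[atTop] fun t : ℕ => c ^ t := by
    refine IsBigO.of_bound 1 ?_
    filter_upwards [hev, eventually_gt_atTop 0] with t ht ht0
    rw [ENNReal.ofReal_lt_ofReal_iff hc0, one_div,
      Real.rpow_inv_lt_iff_of_pos (norm_nonneg _) hc0.le (by positivity), Real.rpow_natCast] at ht
    rw [one_mul, Real.norm_of_nonneg (by positivity)]
    exact ht.le
  obtain ⟨K, hK0, hK⟩ := bound_of_isBigO_nat_atTop hbig
  refine ⟨K, hK0.le, fun t => ?_⟩
  have := @hK t (by positivity)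
  rwa [Real.norm_of_nonneg (by positivity)] at this

/-- With `c` strictly between the spectral radius and `β`, the terms of the series are dominated by
a geometric series of ratio `(c/β)²`. The lower bound is the term `t = 0`. -/
theorem exists_isNormEquivConst (B : Matrix n n ℝ) {β : ℝ} (hβ : specRadius B < β) :
    ∃ C, IsNormEquivConst B β C := by
  obtain ⟨c, hc, hcβ⟩ := exists_between hβ
  have hr0 : 0 ≤ specRadius B := ENNReal.toReal_nonneg
  have hc0 : 0 < c := hr0.trans_lt hc
  have hβ0 : 0 < β := hc0.trans hcβ
  -- `specRadius` is a `toReal`, so finiteness is needed to recover the bound in `ENNReal`.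
  have htop : spectralRadius ℂ (B.map (algebraMap ℝ ℂ)) ≠ ⊤ := by
    refine ne_top_of_le_ne_top ?_
      (spectrum.spectralRadius_le_pow_nnnorm_pow_one_div ℂ (B.map (algebraMap ℝ ℂ)) 0)
    simp [ENNReal.mul_eq_top]
  obtain ⟨K, hK0, hK⟩ := exists_norm_pow_le (a := B.map (algebraMap ℝ ℂ)) (c := c)
    ((ENNReal.lt_ofReal_iff_toReal_lt htop).2 hc)
  set q : ℝ := (c / β) ^ 2 with hq
  have hq0 : 0 ≤ q := by positivity
  have hq1 : q < 1 := by
    rw [hq, sq_lt_one_iff₀ (by positivity), div_lt_one hβ0]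
    exact hcβ
  have hterm (x : n → ℝ) (t : ℕ) : lyapTerm B β x t ≤ K ^ 2 * l2norm x ^ 2 * q ^ t := by
    have h1 : l2norm ((B ^ t).mulVec x) ≤ K * c ^ t * l2norm x := by
      refine (l2norm_mulVec_le _ _).trans (mul_le_mul_of_nonneg_right ?_ (l2norm_nonneg _))
      have := hK t
      rwa [← (algebraMap ℝ ℂ).mapMatrix_apply, ← map_pow] at this
    rw [lyapTerm, inv_mul_le_iff₀ (by positivity)]
    calc l2norm ((B ^ t).mulVec x) ^ 2 ≤ (K * c ^ t * l2norm x) ^ 2 := by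
          gcongr
          exact l2norm_nonneg _
      _ = β ^ (2 * t) * (K ^ 2 * l2norm x ^ 2 * q ^ t) := by
          rw [hq, ← pow_mul, div_pow]
          field_simp
          ring
  have hnn (x : n → ℝ) (t : ℕ) : 0 ≤ lyapTerm B β x t := by
    unfold lyapTerm; positivity
  have hsum (x : n → ℝ) : Summable (lyapTerm B β x) :=
    Summable.of_nonneg_of_le (hnn x) (hterm x)
      ((summable_geometric_of_lt_one hq0 hq1).mul_left _)
  refine ⟨max 1 (K ^ 2 * (1 - q)⁻¹), le_max_left _ _, fun x => ⟨hsum x, ?_, ?_⟩⟩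
  · have := (hsum x).le_tsum 0 fun t _ => hnn x t
    simpa [lyap, lyapTerm] using this
  · calc lyap B β x ≤ ∑' t, K ^ 2 * l2norm x ^ 2 * q ^ t :=
          (hsum x).tsum_le_tsum (hterm x) ((summable_geometric_of_lt_one hq0 hq1).mul_left _)
      _ = K ^ 2 * (1 - q)⁻¹ * l2norm x ^ 2 := by
          rw [tsum_mul_left, tsum_geometric_of_lt_one hq0 hq1]; ring
      _ ≤ _ := by
          gcongr
          exact le_max_right _ _

end

/-- A single term of a nonnegative series is at most its sum. The moment estimates use the Lyapunov
function only through this bound. -/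
theorem IsNormEquivConst.l2norm_pow_mulVec_sq_le {B : Matrix n n ℝ} {β C : ℝ}
    (h : IsNormEquivConst B β C) (hβ : 0 < β) (x : n → ℝ) (t : ℕ) :
    l2norm ((B ^ t).mulVec x) ^ 2 ≤ β ^ (2 * t) * (C * l2norm x ^ 2) := by
  obtain ⟨hs, -, hC⟩ := h.2 x
  rw [← inv_mul_le_iff₀ (by positivity)]
  exact (hs.le_tsum t fun t _ => by unfold lyapTerm; positivity).trans hC

end SpectralRadius

/-! ### The mode matrices `A_π`: positivity and stability. -/

namespace DiscountedMDP

variable {S A : Type*} [Fintype S] [Fintype A] [DecidableEq S] [DecidableEq A]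

theorem modeMatrix_apply (M : DiscountedMDP S A) (d : S × A → ℝ) (α : ℝ) (π : S → A)
    (x y : S × A) :
    M.modeMatrix d α π x y = (if x = y then 1 - α * d x else 0)
      + α * M.γ * (d x * M.stepMean (fun s' => if y = (s', π s') then 1 else 0) x) := by
  have h : (Matrix.diagonal d * M.transMatrix *
      Matrix.of fun (s : S) (x : S × A) => if x = (s, π s) then (1 : ℝ) else 0) x y
        = d x * M.stepMean (fun s' => if y = (s', π s') then 1 else 0) x := by
    rw [Matrix.mul_apply, stepMean, Finset.mul_sum]
    exact Finset.sum_congr rfl fun s' _ => by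
      rw [Matrix.diagonal_mul, transMatrix, Matrix.of_apply, Matrix.of_apply, mul_assoc]
  rw [modeMatrix, Matrix.add_apply, Matrix.smul_apply, h, Matrix.sub_apply, Matrix.smul_apply,
    Matrix.one_apply, Matrix.diagonal_apply, smul_eq_mul, smul_eq_mul]
  split_ifs <;> simp

theorem modeMatrix_mulVec (M : DiscountedMDP S A) (d : S × A → ℝ) (α : ℝ) (π : S → A)
    (e : S × A → ℝ) (x : S × A) :
    (M.modeMatrix d α π).mulVec e x
      = e x - α * d x * e x + α * M.γ * (d x * M.stepMean (fun s' => e (s', π s')) x) := by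
  simp only [Matrix.mulVec, dotProduct, modeMatrix_apply, add_mul, Finset.sum_add_distrib,
    ite_mul, zero_mul, Finset.sum_ite_eq, Finset.mem_univ, if_true, one_mul, sub_mul]
  congr 1
  simp only [stepMean, Finset.mul_sum, Finset.sum_mul, mul_ite, mul_one, mul_zero]
  rw [Finset.sum_comm]
  simp [mul_assoc]

theorem modeMatrix_nonneg (M : DiscountedMDP S A) {d : S × A → ℝ} {α : ℝ} (hα : 0 ≤ α)
    (hd0 : ∀ x, 0 ≤ d x) (hd1 : ∀ x, α * d x ≤ 1) (π : S → A) (x y : S × A) :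
    0 ≤ M.modeMatrix d α π x y := by
  rw [modeMatrix_apply]
  have h1 : 0 ≤ M.stepMean (fun s' => if y = (s', π s') then (1 : ℝ) else 0) x := by
    refine (M.stepMean_const 0 x).symm.le.trans (M.stepMean_mono (fun s => ?_) x)
    split_ifs <;> norm_num
  have h2 := M.γ_pos.le
  have h3 := hd0 x
  have h4 := hd1 x
  have h5 : 0 ≤ if x = y then 1 - α * d x else 0 := by split_ifs <;> linarith
  positivity

theorem modeMatrix_mulVec_mono (M : DiscountedMDP S A) {d : S × A → ℝ} {α : ℝ} (hα : 0 ≤ α)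
    (hd0 : ∀ x, 0 ≤ d x) (hd1 : ∀ x, α * d x ≤ 1) (π : S → A) {e f : S × A → ℝ} (h : e ≤ f) :
    (M.modeMatrix d α π).mulVec e ≤ (M.modeMatrix d α π).mulVec f := fun x =>
  Finset.sum_le_sum fun y _ =>
    mul_le_mul_of_nonneg_left (h y) (M.modeMatrix_nonneg hα hd0 hd1 π x y)

/-- The row of the nonnegative matrix `A_π` at `x` sums to `1 - α d(x) (1 - γ) < 1`. -/
theorem specRadius_modeMatrix_lt_one [Nonempty S] [Nonempty A] (M : DiscountedMDP S A)
    {d : S × A → ℝ} {α : ℝ} (hα : 0 < α) (hd0 : ∀ x, 0 < d x) (hd1 : ∀ x, α * d x ≤ 1)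
    (π : S → A) : specRadius (M.modeMatrix d α π) < 1 := by
  refine specRadius_lt_one_of_sum_lt_one
    (M.modeMatrix_nonneg hα.le (fun x => (hd0 x).le) hd1 π) fun x => ?_
  have h : ∑ y, M.modeMatrix d α π x y = (M.modeMatrix d α π).mulVec (fun _ => 1) x := by
    simp [Matrix.mulVec, dotProduct]
  rw [h, modeMatrix_mulVec, stepMean_const]
  have := mul_pos (mul_pos hα (hd0 x)) (sub_pos.2 M.γ_lt_one)
  linarith

theorem exists_isOptimizedPolicy [Nonempty A] [MeasurableSpace S] [MeasurableSpace A]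
    [MeasurableSingletonClass S] [MeasurableSingletonClass A] (M : DiscountedMDP S A)
    (d : S × A → ℝ) (α : ℝ) : ∃ π, IsOptimizedPolicy M d α π :=
  Set.exists_min_image M.optPolicies (fun π => specRadius (M.modeMatrix d α π)) (Set.toFinite _)
    M.optPolicies_nonempty

end DiscountedMDP

/-! ### The sampling distribution. -/

section Sampling

variable {S A : Type*}

theorem samplingProb_nonneg (p : PMF S) (b : S → PMF A) (x : S × A) : 0 ≤ samplingProb p b x :=
  ENNReal.toReal_nonneg

variable [Fintype S] [Fintype A]

theorem sum_samplingProb (p : PMF S) (b : S → PMF A) : ∑ x, samplingProb p b x = 1 := by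
  simp only [samplingProb, Fintype.sum_prod_type, ENNReal.toReal_mul, ← Finset.mul_sum,
    PMF.sum_toReal, mul_one]

theorem samplingProb_le_one (p : PMF S) (b : S → PMF A) (x : S × A) : samplingProb p b x ≤ 1 := by
  rw [← sum_samplingProb p b]
  exact Finset.single_le_sum (fun y _ => samplingProb_nonneg p b y) (Finset.mem_univ x)

end Sampling

/-! ### Q-learning: bounded iterates, centered noise and the comparison system. -/

namespace DiscountedMDP

variable {S A : Type*}

/-- The temporal difference at the observation `o = (s, a, s')` for the table `Q`. -/
def tdError (M : DiscountedMDP S A) (Q : S × A → ℝ) (o : S × A × S) : ℝ :=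
  M.r o.1 o.2.1 o.2.2 + M.γ * (⨆ u, Q (o.2.2, u)) - Q (o.1, o.2.1)

/-- Bound on all iterates of Q-learning. -/
def iterBound (M : DiscountedMDP S A) (Q₀ : S × A → ℝ) [Fintype S] [Fintype A] : ℝ :=
  max ‖Q₀‖ (M.rewardMax / (1 - M.γ))

/-- Bound on the temporal differences along Q-learning. -/
def tdBound (M : DiscountedMDP S A) (Q₀ : S × A → ℝ) [Fintype S] [Fintype A] : ℝ :=
  M.rewardMax + (1 + M.γ) * M.iterBound Q₀

section Bounds

variable [Fintype A]

theorem le_iSup_action (Q : S × A → ℝ) (s : S) (a : A) : Q (s, a) ≤ ⨆ u, Q (s, u) :=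
  le_ciSup (f := fun u => Q (s, u)) (Set.finite_range _).bddAbove a

theorem abs_iSup_action_le [Nonempty A] {Q : S × A → ℝ} {c : ℝ} (h : ∀ x, |Q x| ≤ c) (s : S) :
    |⨆ u, Q (s, u)| ≤ c := by
  obtain ⟨u, hu⟩ := exists_eq_ciSup_of_finite (f := fun u => Q (s, u))
  rw [← hu]
  exact h _

variable [Fintype S]

theorem iterBound_nonneg (M : DiscountedMDP S A) (Q₀ : S × A → ℝ) : 0 ≤ M.iterBound Q₀ :=
  (norm_nonneg _).trans (le_max_left _ _)

theorem tdBound_nonneg (M : DiscountedMDP S A) (Q₀ : S × A → ℝ) : 0 ≤ M.tdBound Q₀ :=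
  add_nonneg M.rewardMax_nonneg
    (mul_nonneg (by linarith [M.γ_pos]) (M.iterBound_nonneg Q₀))

/-- The ball of radius `iterBound` is invariant: targets computed from a table in it stay in it. -/
theorem rewardMax_add_le_iterBound (M : DiscountedMDP S A) (Q₀ : S × A → ℝ) :
    M.rewardMax + M.γ * M.iterBound Q₀ ≤ M.iterBound Q₀ := by
  have h : M.rewardMax / (1 - M.γ) ≤ M.iterBound Q₀ := le_max_right _ _
  rw [div_le_iff₀ (sub_pos.2 M.γ_lt_one)] at h
  linarith

theorem abs_target_le [Nonempty A] (M : DiscountedMDP S A) {Q : S × A → ℝ} {c : ℝ}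
    (h : ∀ x, |Q x| ≤ c) (s : S) (a : A) (s' : S) :
    |M.r s a s' + M.γ * ⨆ u, Q (s', u)| ≤ M.rewardMax + M.γ * c := by
  refine (abs_add_le _ _).trans (add_le_add (M.abs_reward_le _ _ _) ?_)
  rw [abs_mul, abs_of_pos M.γ_pos]
  exact mul_le_mul_of_nonneg_left (abs_iSup_action_le h s') M.γ_pos.le

theorem abs_tdError_le [Nonempty A] (M : DiscountedMDP S A) {Q Q₀ : S × A → ℝ}
    (h : ∀ x, |Q x| ≤ M.iterBound Q₀) (o : S × A × S) : |M.tdError Q o| ≤ M.tdBound Q₀ := by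
  have h1 := M.abs_target_le h o.1 o.2.1 o.2.2
  have h2 := h (o.1, o.2.1)
  refine (abs_sub _ _).trans ?_
  unfold tdBound
  linarith

/-- Conditional expectation of the increment of Q-learning (without the step size) given the
table `Q`. -/
def meanIncrement (M : DiscountedMDP S A) (d : S × A → ℝ) (Q : S × A → ℝ) (x : S × A) : ℝ :=
  d x * M.stepMean (fun s' => M.tdError Q (x.1, x.2, s')) x

theorem l2norm_meanIncrement_le [Nonempty A] (M : DiscountedMDP S A) {d : S × A → ℝ}
    (hd0 : ∀ x, 0 ≤ d x) (hd1 : ∑ x, d x = 1) {Q Q₀ : S × A → ℝ}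
    (h : ∀ x, |Q x| ≤ M.iterBound Q₀) : l2norm (M.meanIncrement d Q) ≤ M.tdBound Q₀ := by
  refine (l2norm_le_sum_abs _).trans ?_
  calc ∑ x, |M.meanIncrement d Q x| ≤ ∑ x, d x * M.tdBound Q₀ := by
        refine Finset.sum_le_sum fun x _ => ?_
        rw [meanIncrement, abs_mul, abs_of_nonneg (hd0 x)]
        exact mul_le_mul_of_nonneg_left
          (M.abs_stepMean_le (fun s => M.abs_tdError_le h _) x) (hd0 x)
    _ = M.tdBound Q₀ := by rw [← Finset.sum_mul, hd1, one_mul]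

end Bounds

variable [DecidableEq S] [DecidableEq A]

/-- The increment of Q-learning (without the step size). -/
def increment (M : DiscountedMDP S A) (Q : S × A → ℝ) (o : S × A × S) : S × A → ℝ :=
  Pi.single (o.1, o.2.1) (M.tdError Q o)

theorem qIter_succ (M : DiscountedMDP S A) (α : ℝ) (Q₀ : S × A → ℝ) (o : ℕ → S × A × S) (k : ℕ) :
    M.qIter α Q₀ o (k + 1)
      = M.qIter α Q₀ o k + α • M.increment (M.qIter α Q₀ o k) (o k) := by
  ext x
  simp only [qIter, increment, tdError, Function.update_apply, Pi.add_apply, Pi.smul_apply,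
    Pi.single_apply, smul_eq_mul]
  split_ifs with h
  · rw [h]
  · simp

theorem dependsOn_qIter (M : DiscountedMDP S A) (α : ℝ) (Q₀ : S × A → ℝ) (k : ℕ) :
    DependsOn (fun o => M.qIter α Q₀ o k) (Set.Iio k) := by
  induction k with
  | zero => exact fun _ _ _ => rfl
  | succ k ih =>
    intro o o' h
    have h1 := ih fun j hj => h j (Nat.lt_succ_of_lt hj)
    have h2 := h k (Nat.lt_succ_self k)
    simp only at h1 ⊢
    rw [qIter_succ, qIter_succ, h1, h2]

variable [Fintype S] [Fintype A]

theorem abs_qIter_le [Nonempty A] (M : DiscountedMDP S A) {α : ℝ} (hα0 : 0 ≤ α) (hα1 : α ≤ 1)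
    (Q₀ : S × A → ℝ) (o : ℕ → S × A × S) (k : ℕ) (x : S × A) :
    |M.qIter α Q₀ o k x| ≤ M.iterBound Q₀ := by
  induction k generalizing x with
  | zero => exact (norm_le_pi_norm Q₀ x).trans (le_max_left _ _)
  | succ k ih =>
    simp only [qIter, Function.update_apply]
    split_ifs with h
    · set q := M.qIter α Q₀ o k
      have h1 := (M.abs_target_le ih (o k).1 (o k).2.1 (o k).2.2).trans
        (M.rewardMax_add_le_iterBound Q₀)
      have h2 := ih ((o k).1, (o k).2.1)
      rw [abs_le] at h1 h2 ⊢
      -- The new entry is the convex combination of the old entry and the target with weights `1 -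
      -- α` and `α`.
      constructor <;> nlinarith
    · exact ih x

/-- The centered noise of Q-learning at the table `Q`. -/
def noise (M : DiscountedMDP S A) (d : S × A → ℝ) (Q : S × A → ℝ) (o : S × A × S) : S × A → ℝ :=
  M.increment Q o - M.meanIncrement d Q

theorem l2norm_noise_sq_le [Nonempty S] [Nonempty A] (M : DiscountedMDP S A) {d : S × A → ℝ}
    (hd0 : ∀ x, 0 ≤ d x) (hd1 : ∑ x, d x = 1) {Q Q₀ : S × A → ℝ}
    (h : ∀ x, |Q x| ≤ M.iterBound Q₀) (o : S × A × S) :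
    l2norm (M.noise d Q o) ^ 2 ≤ M.noiseMax Q₀ := by
  have hB := M.tdBound_nonneg Q₀
  have h1 : l2norm (M.noise d Q o) ≤ (1 + 1) * M.tdBound Q₀ := by
    refine (l2norm_sub_le _ _).trans ?_
    rw [increment, l2norm_single]
    -- The increment has one nonzero coordinate, and its mean is controlled in the `ℓ¹` norm, so
    -- each contributes one `tdBound`. The factor `2` is then enlarged to `1 + √(|S||A|)` to match
    -- `noiseMax`.
    linarith [M.abs_tdError_le h o, M.l2norm_meanIncrement_le hd0 hd1 h]
  have h2 : (1 : ℝ) ≤ √((Fintype.card S : ℝ) * Fintype.card A) := by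
    rw [Real.one_le_sqrt]
    exact one_le_mul_of_one_le_of_one_le (by exact_mod_cast Fintype.card_pos)
      (by exact_mod_cast Fintype.card_pos)
  have h3 : l2norm (M.noise d Q o) ≤
      (1 + √((Fintype.card S : ℝ) * Fintype.card A)) * M.tdBound Q₀ := h1.trans (by gcongr)
  calc l2norm (M.noise d Q o) ^ 2
      ≤ ((1 + √((Fintype.card S : ℝ) * Fintype.card A)) * M.tdBound Q₀) ^ 2 := by
        gcongr
        exact l2norm_nonneg _
    _ = M.noiseMax Q₀ := mul_pow _ _ _

/-- The noise has mean zero under the sampling law. -/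
theorem sum_mul_noise (M : DiscountedMDP S A) {d : S × A → ℝ} (hd1 : ∑ x, d x = 1)
    (Q : S × A → ℝ) (x : S × A) :
    ∑ o : S × A × S, d (o.1, o.2.1) * (M.P o.1 o.2.1 o.2.2).toReal * M.noise d Q o x = 0 := by
  have h1 : ∑ o : S × A × S, d (o.1, o.2.1) * (M.P o.1 o.2.1 o.2.2).toReal = 1 := by
    simp only [Fintype.sum_prod_type, ← Finset.mul_sum, PMF.sum_toReal, mul_one]
    rw [← hd1, Fintype.sum_prod_type]
  have h2 : ∑ o : S × A × S, d (o.1, o.2.1) * (M.P o.1 o.2.1 o.2.2).toReal * M.increment Q o x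
      = M.meanIncrement d Q x := by
    have h3 : ∀ y : S × A, ∑ s', d y * (M.P y.1 y.2 s').toReal * M.increment Q (y.1, y.2, s') x
        = if x = y then M.meanIncrement d Q y else 0 := fun y => by
      split_ifs with h
      · subst h
        simp [increment, meanIncrement, stepMean, Finset.mul_sum, mul_assoc]
      · simp [increment, h]
    have h4 : ∑ y : S × A, ∑ s', d y * (M.P y.1 y.2 s').toReal * M.increment Q (y.1, y.2, s') x
        = M.meanIncrement d Q x := by simp [h3]
    rw [← h4, Fintype.sum_prod_type, Fintype.sum_prod_type]
    exact Finset.sum_congr rfl fun s _ => Fintype.sum_prod_type _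
  simp only [noise, Pi.sub_apply, mul_sub, Finset.sum_sub_distrib, h2, ← Finset.sum_mul, h1,
    one_mul, sub_self]

/-- The linear comparison system driven by the noise of Q-learning. -/
def lowerIter (M : DiscountedMDP S A) (d : S × A → ℝ) (α : ℝ) (π : S → A) (Q₀ y₀ : S × A → ℝ)
    (o : ℕ → S × A × S) : ℕ → S × A → ℝ
  | 0 => y₀
  | k + 1 => (M.modeMatrix d α π).mulVec (lowerIter M d α π Q₀ y₀ o k)
      + α • M.noise d (M.qIter α Q₀ o k) (o k)

theorem dependsOn_lowerIter (M : DiscountedMDP S A) (d : S × A → ℝ) (α : ℝ) (π : S → A)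
    (Q₀ y₀ : S × A → ℝ) (k : ℕ) :
    DependsOn (fun o => M.lowerIter d α π Q₀ y₀ o k) (Set.Iio k) := by
  induction k with
  | zero => exact fun _ _ _ => rfl
  | succ k ih =>
    intro o o' h
    have h1 := ih fun j hj => h j (Nat.lt_succ_of_lt hj)
    have h2 := h k (Nat.lt_succ_self k)
    have h3 := M.dependsOn_qIter α Q₀ k fun j hj => h j (Nat.lt_succ_of_lt hj)
    simp only at h1 h3
    simp only [lowerIter, h1, h2, h3]

variable [MeasurableSpace S] [MeasurableSpace A] [MeasurableSingletonClass S]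
  [MeasurableSingletonClass A]

/-- One mean step of Q-learning dominates the linear system of an optimal policy. -/
theorem modeMatrix_mulVec_le (M : DiscountedMDP S A) {d : S × A → ℝ} {α : ℝ} (hα : 0 ≤ α)
    (hd0 : ∀ x, 0 ≤ d x) {π : S → A} (hπ : π ∈ M.optPolicies) (Q : S × A → ℝ) :
    (M.modeMatrix d α π).mulVec (Q - M.optQ) ≤ Q - M.optQ + α • M.meanIncrement d Q := by
  intro x
  have h1 : M.stepMean (fun s' => M.tdError Q (x.1, x.2, s')) x
      = M.meanReward x + M.γ * M.stepMean (fun s' => ⨆ u, Q (s', u)) x - Q x := by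
    simp only [tdError]
    rw [stepMean_sub, stepMean_add, stepMean_const_mul, stepMean_const]
    rfl
  have h2 : M.stepMean (fun s' => Q (s', π s')) x ≤ M.stepMean (fun s' => ⨆ u, Q (s', u)) x :=
    M.stepMean_mono (fun s => le_iSup_action Q s (π s)) x
  have h3 := M.optQ_le hπ x
  rw [modeMatrix_mulVec]
  simp only [Pi.add_apply, Pi.smul_apply, smul_eq_mul, meanIncrement, h1, Pi.sub_apply,
    stepMean_sub]
  have h4 := mul_le_mul_of_nonneg_left h2 M.γ_pos.le
  have h5 := mul_nonneg hα (hd0 x)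
  -- The gap between the two sides is `α d(x)` times the sum of two slacks: `γ` times that of the
  -- maximum over actions, and that of the Bellman inequality for `Q*`.
  nlinarith [mul_nonneg h5 (sub_nonneg.2 (add_le_add h3 h4))]

/-- Both recursions carry the same noise, so it cancels, and positivity of `A_π` propagates the
order. -/
theorem lowerIter_le (M : DiscountedMDP S A) {d : S × A → ℝ} {α : ℝ} (hα : 0 ≤ α)
    (hd0 : ∀ x, 0 ≤ d x) (hd1 : ∀ x, α * d x ≤ 1) {π : S → A} (hπ : π ∈ M.optPolicies)
    {Q₀ y₀ : S × A → ℝ} (hy : y₀ ≤ Q₀ - M.optQ) (o : ℕ → S × A × S) (k : ℕ) :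
    M.lowerIter d α π Q₀ y₀ o k ≤ M.qIter α Q₀ o k - M.optQ := by
  induction k with
  | zero => exact hy
  | succ k ih =>
    have h := (M.modeMatrix_mulVec_mono hα hd0 hd1 π ih).trans (M.modeMatrix_mulVec_le hα hd0 hπ _)
    rw [qIter_succ, lowerIter]
    intro x
    have := h x
    simp only [noise, Pi.add_apply, Pi.smul_apply, smul_eq_mul, Pi.sub_apply] at this ⊢
    linarith

theorem orthantDist_le [Nonempty S] [Nonempty A] (M : DiscountedMDP S A) {α : ℝ}
    {Q₀ y : S × A → ℝ} {k : ℕ} {o : ℕ → S × A × S} (h : y ≤ M.qIter α Q₀ o k - M.optQ) :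
    orthantDist M α Q₀ k o ≤ l2norm y := by
  set e := M.qIter α Q₀ o k - M.optQ with he
  -- Raising every coordinate of `e` by `‖y‖₂` reaches the orthant, at sup distance `‖y‖₂`.
  have hmem : (e + fun _ => l2norm y) ∈ {z : S × A → ℝ | 0 ≤ z} := fun x => by
    have := h x
    have := (abs_le.1 (abs_apply_le_l2norm y x)).1
    simp only [Pi.zero_apply, Pi.add_apply]
    linarith
  refine (Metric.infDist_le_dist_of_mem hmem).trans ?_
  rw [dist_self_add_right, pi_norm_const, Real.norm_of_nonneg (l2norm_nonneg y)]

end DiscountedMDP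

/-! ### Functionals of finitely many independent observations. -/

section FiniteHistory

variable {O Ω : Type*}

theorem exists_comp_restrict_of_dependsOn [Nonempty O] {E : Type*} {F : (ℕ → O) → E} {k : ℕ}
    (hF : DependsOn F (Set.Iio k)) :
    ∃ G : (Finset.range k → O) → E, ∀ o, F o = G fun i => o i := by
  classical
  -- Coordinates from `k` on do not affect `F`, so they are filled with an arbitrary value.
  refine ⟨fun h => F fun j => if hj : j ∈ Finset.range k then h ⟨j, hj⟩ else Classical.arbitrary O,
    fun o => hF fun j hj => ?_⟩
  simp [Set.mem_Iio.1 hj]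

variable [Finite O] [MeasurableSpace O] [MeasurableSingletonClass O] [MeasurableSpace Ω]
  {μ : Measure Ω} {obs : ℕ → Ω → O}

theorem integrable_of_dependsOn [Nonempty O] [IsFiniteMeasure μ] (hm : ∀ k, Measurable (obs k))
    {F : (ℕ → O) → ℝ} {k : ℕ} (hF : DependsOn F (Set.Iio k)) :
    Integrable (fun ω => F fun j => obs j ω) μ := by
  obtain ⟨G, hG⟩ := exists_comp_restrict_of_dependsOn hF
  simp_rw [hG]
  exact (Integrable.of_finite (f := G)).comp_measurable
    (measurable_pi_lambda (fun ω (i : Finset.range k) => obs i ω) fun i => hm i)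

/-- Conditioning on the first `k` observations: they are independent of the `k`-th, so Fubini
averages over the latter with the history frozen. -/
theorem integral_eq_integral_sum_of_dependsOn [Fintype O] [Nonempty O] [IsProbabilityMeasure μ]
    (hm : ∀ k, Measurable (obs k)) (hind : iIndepFun obs μ) {F : (ℕ → O) → O → ℝ} {k : ℕ}
    (hF : DependsOn F (Set.Iio k)) :
    ∫ ω, F (fun j => obs j ω) (obs k ω) ∂μ
      = ∫ ω, ∑ z, μ.real {ω' | obs k ω' = z} * F (fun j => obs j ω) z ∂μ := by
  obtain ⟨G, hG⟩ := exists_comp_restrict_of_dependsOn hF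
  simp_rw [hG]
  let H : Ω → Finset.range k → O := fun ω i => obs i ω
  have hH : Measurable H := measurable_pi_lambda _ fun i => hm i
  have hi : IndepFun H (obs k) μ := by
    have := hind.indepFun_finset (Finset.range k) {k} (by simp) hm
    exact this.comp (φ := id) (ψ := fun h : (({k} : Finset ℕ) → O) => h ⟨k, by simp⟩)
      measurable_id (measurable_pi_apply _)
  have hmap := hi.map_prod_eq_prod_map_map hH.aemeasurable (hm k).aemeasurable
  have : IsProbabilityMeasure (μ.map (obs k)) :=
    Measure.isProbabilityMeasure_map (hm k).aemeasurable
  have : IsProbabilityMeasure (μ.map H) := Measure.isProbabilityMeasure_map hH.aemeasurable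
  calc ∫ ω, G (H ω) (obs k ω) ∂μ = ∫ z, G z.1 z.2 ∂(μ.map fun ω => (H ω, obs k ω)) := by
        rw [integral_map (hH.prodMk (hm k)).aemeasurable
          (measurable_of_countable fun z : (Finset.range k → O) × O =>
            G z.1 z.2).aestronglyMeasurable]
    _ = ∫ h, ∫ z, G h z ∂(μ.map (obs k)) ∂(μ.map H) := by
        rw [hmap, integral_prod _ Integrable.of_finite]
    _ = ∫ h, ∑ z, μ.real {ω' | obs k ω' = z} * G h z ∂(μ.map H) := by
        congr 1 with h
        rw [integral_fintype Integrable.of_finite]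
        refine Finset.sum_congr rfl fun z _ => ?_
        rw [map_measureReal_apply (hm k) (measurableSet_singleton z), smul_eq_mul]
        rfl
    _ = _ := by
        rw [integral_map hH.aemeasurable (measurable_of_countable _).aestronglyMeasurable]

end FiniteHistory

/-- Pythagoras in mean: the cross term is linear in `v` and averages to zero. -/
theorem sum_mul_l2norm_add_sq {ι n : Type*} [Fintype ι] [Fintype n] {q : ι → ℝ}
    (hq : ∑ z, q z = 1) (u : n → ℝ) {v : ι → n → ℝ} (hv : ∀ i, ∑ z, q z * v z i = 0) :
    ∑ z, q z * l2norm (u + v z) ^ 2 = l2norm u ^ 2 + ∑ z, q z * l2norm (v z) ^ 2 := by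
  have h : ∀ z, q z * l2norm (u + v z) ^ 2
      = q z * l2norm u ^ 2 + 2 * ∑ i, u i * (q z * v z i) + q z * l2norm (v z) ^ 2 := fun z => by
    simp only [l2norm_sq, Finset.mul_sum, ← Finset.sum_add_distrib]
    exact Finset.sum_congr rfl fun i _ => by simp only [Pi.add_apply]; ring
  simp only [h, Finset.sum_add_distrib, ← Finset.sum_mul, hq, one_mul, ← Finset.mul_sum]
  rw [Finset.sum_comm]
  simp [← Finset.mul_sum, hv]

/-- Nonnegativity of the variance. -/
theorem integral_le_sqrt_integral_sq {Ω : Type*} [MeasurableSpace Ω] {μ : Measure Ω}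
    [IsProbabilityMeasure μ] {f : Ω → ℝ} (hf : Integrable f μ)
    (hf2 : Integrable (fun ω => f ω ^ 2) μ) :
    ∫ ω, f ω ∂μ ≤ √(∫ ω, f ω ^ 2 ∂μ) := by
  refine Real.le_sqrt_of_sq_le ?_
  set m := ∫ ω, f ω ∂μ with hm
  have h0 : 0 ≤ ∫ ω, (f ω - m) ^ 2 ∂μ := integral_nonneg fun ω => sq_nonneg _
  have h1 : ∫ ω, (f ω - m) ^ 2 ∂μ = ∫ ω, f ω ^ 2 ∂μ - m ^ 2 := by
    have : ∀ ω, (f ω - m) ^ 2 = f ω ^ 2 - (2 * m * f ω - m ^ 2) := fun ω => by ring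
    simp_rw [this]
    have hi : Integrable (fun ω => 2 * m * f ω - m ^ 2) μ :=
      (hf.const_mul _).sub (integrable_const _)
    rw [integral_sub hf2 hi, integral_sub (hf.const_mul _) (integrable_const _),
      integral_const_mul, ← hm]
    simp
    ring
  linarith

/-! ### Moment bounds for the comparison system. -/

namespace DiscountedMDP

variable {S A Ω : Type*} [Fintype S] [Fintype A] [Nonempty S] [Nonempty A] [DecidableEq S]
  [DecidableEq A] [MeasurableSpace S] [MeasurableSpace A] [MeasurableSingletonClass S]
  [MeasurableSingletonClass A] [MeasurableSpace Ω] {μ : Measure Ω} [IsProbabilityMeasure μ]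
  {M : DiscountedMDP S A} {p : PMF S} {b : S → PMF A} {obs : ℕ → Ω → S × A × S}

/-- One step of the second-moment recursion of the comparison system. -/
theorem integral_l2norm_lowerIter_succ_le (hobs : IsIIDObservation M p b μ obs) {α : ℝ}
    (hα0 : 0 ≤ α) (hα1 : α ≤ 1) (π : S → A) (Q₀ y₀ : S × A → ℝ)
    (L : Matrix (S × A) (S × A) ℝ) {c : ℝ} (hc0 : 0 ≤ c)
    (hc : ∀ x, l2norm (L.mulVec x) ^ 2 ≤ c * l2norm x ^ 2) (k : ℕ) :
    ∫ ω, l2norm (L.mulVec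
        (M.lowerIter (samplingProb p b) α π Q₀ y₀ (fun j => obs j ω) (k + 1))) ^ 2 ∂μ
      ≤ ∫ ω, l2norm ((L * M.modeMatrix (samplingProb p b) α π).mulVec
          (M.lowerIter (samplingProb p b) α π Q₀ y₀ (fun j => obs j ω) k)) ^ 2 ∂μ
        + α ^ 2 * (c * M.noiseMax Q₀) := by
  set d := samplingProb p b with hd
  set B := M.modeMatrix d α π with hB
  let q : S × A × S → ℝ := fun o => d (o.1, o.2.1) * (M.P o.1 o.2.1 o.2.2).toReal
  have hd1 : ∑ x, d x = 1 := sum_samplingProb p b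
  have hd0 : ∀ x, 0 ≤ d x := samplingProb_nonneg p b
  have hlaw : ∀ z, μ.real {ω | obs k ω = z} = q z := fun z => by
    rw [measureReal_def, hobs.law k z.1 z.2.1 z.2.2, ENNReal.toReal_mul]
    rfl
  have hq0 : ∀ z, 0 ≤ q z := fun z => mul_nonneg (hd0 _) ENNReal.toReal_nonneg
  have hq1 : ∑ z, q z = 1 := by
    simp only [q, Fintype.sum_prod_type, ← Finset.mul_sum, PMF.sum_toReal, mul_one]
    rw [← hd1, Fintype.sum_prod_type]
  let y : (ℕ → S × A × S) → S × A → ℝ := fun o => M.lowerIter d α π Q₀ y₀ o k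
  let w : (ℕ → S × A × S) → S × A × S → S × A → ℝ := fun o => M.noise d (M.qIter α Q₀ o k)
  have hy : DependsOn y (Set.Iio k) := M.dependsOn_lowerIter d α π Q₀ y₀ k
  let F : (ℕ → S × A × S) → S × A × S → ℝ := fun o z =>
    l2norm ((L * B).mulVec (y o) + α • L.mulVec (w o z)) ^ 2
  have hF : DependsOn F (Set.Iio k) := fun o o' h => by
    have h1 := hy h
    have h2 := M.dependsOn_qIter α Q₀ k h
    simp only at h2
    simp only [F, w, h1, h2]
  have hstep : ∀ ω, l2norm (L.mulVec (M.lowerIter d α π Q₀ y₀ (fun j => obs j ω) (k + 1))) ^ 2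
      = F (fun j => obs j ω) (obs k ω) := fun ω => by
    simp only [F, w, y, lowerIter, Matrix.mulVec_add, Matrix.mulVec_smul, Matrix.mulVec_mulVec, hB]
  have hbound : ∀ o, ∑ z, q z * F o z
      ≤ l2norm ((L * B).mulVec (y o)) ^ 2 + α ^ 2 * (c * M.noiseMax Q₀) := fun o => by
    -- The noise is centered for the frozen table, and the linear map `L` preserves this.
    have hz : ∀ i, ∑ z, q z * (α • L.mulVec (w o z)) i = 0 := fun i => by
      have h1 : ∀ z, q z * (α • L.mulVec (w o z)) i
          = ∑ x, α * L i x * (q z * w o z x) := fun z => by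
        simp only [Pi.smul_apply, Matrix.mulVec, dotProduct, smul_eq_mul, Finset.mul_sum]
        exact Finset.sum_congr rfl fun x _ => by ring
      simp_rw [h1]
      rw [Finset.sum_comm]
      refine Finset.sum_eq_zero fun x _ => ?_
      rw [← Finset.mul_sum]
      exact mul_eq_zero_of_right _ (M.sum_mul_noise hd1 _ x)
    rw [sum_mul_l2norm_add_sq hq1 _ hz]
    gcongr
    have h2 : ∀ z, l2norm (α • L.mulVec (w o z)) ^ 2 ≤ α ^ 2 * (c * M.noiseMax Q₀) := fun z => by
      have h3 : l2norm (α • L.mulVec (w o z)) ^ 2 = α ^ 2 * l2norm (L.mulVec (w o z)) ^ 2 := by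
        simp only [l2norm_sq, Pi.smul_apply, smul_eq_mul, mul_pow, Finset.mul_sum]
      rw [h3]
      gcongr
      exact (hc _).trans (mul_le_mul_of_nonneg_left
        (M.l2norm_noise_sq_le hd0 hd1 (M.abs_qIter_le hα0 hα1 Q₀ o k) z) hc0)
    calc ∑ z, q z * l2norm (α • L.mulVec (w o z)) ^ 2
        ≤ ∑ z, q z * (α ^ 2 * (c * M.noiseMax Q₀)) :=
          Finset.sum_le_sum fun z _ => mul_le_mul_of_nonneg_left (h2 z) (hq0 z)
      _ = α ^ 2 * (c * M.noiseMax Q₀) := by rw [← Finset.sum_mul, hq1, one_mul]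
  have hI1 : Integrable (fun ω => ∑ z, q z * F (fun j => obs j ω) z) μ :=
    integrable_of_dependsOn (k := k) (F := fun o => ∑ z, q z * F o z) hobs.measurable
      fun o o' h => by simp only [hF h]
  have hI2 : Integrable (fun ω => l2norm ((L * B).mulVec (y fun j => obs j ω)) ^ 2) μ :=
    integrable_of_dependsOn (k := k) (F := fun o => l2norm ((L * B).mulVec (y o)) ^ 2)
      hobs.measurable
      fun o o' h => by simp only [hy h]
  simp_rw [hstep]
  rw [integral_eq_integral_sum_of_dependsOn hobs.measurable hobs.indep hF]
  simp_rw [hlaw]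
  refine (integral_mono hI1 (hI2.add (integrable_const _)) fun ω => hbound _).trans_eq ?_
  simp only [Pi.add_apply]
  rw [integral_add hI2 (integrable_const _)]
  simp [y]

/-- The induction must hold for all `t` at once: one step back in time trades `A^t` for `A^(t+1)`.
Each noise thus pays `C` only once, instead of a factor at every step. -/
theorem integral_l2norm_pow_lowerIter_le (hobs : IsIIDObservation M p b μ obs) {α : ℝ}
    (hα0 : 0 ≤ α) (hα1 : α ≤ 1) (π : S → A) (Q₀ y₀ : S × A → ℝ) {β C : ℝ} (hβ : 0 < β)
    (hC : IsNormEquivConst (M.modeMatrix (samplingProb p b) α π) β C) (k t : ℕ) :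
    ∫ ω, l2norm ((M.modeMatrix (samplingProb p b) α π ^ t).mulVec
        (M.lowerIter (samplingProb p b) α π Q₀ y₀ (fun j => obs j ω) k)) ^ 2 ∂μ
      ≤ β ^ (2 * (t + k)) * (C * l2norm y₀ ^ 2)
        + α ^ 2 * (C * M.noiseMax Q₀) * ∑ j ∈ Finset.range k, β ^ (2 * (t + j)) := by
  have hC0 : 0 ≤ C := zero_le_one.trans hC.1
  induction k generalizing t with
  | zero => simpa [lowerIter] using hC.l2norm_pow_mulVec_sq_le hβ y₀ t
  | succ k ih =>
    refine (integral_l2norm_lowerIter_succ_le hobs hα0 hα1 π Q₀ y₀ _ (c := β ^ (2 * t) * C)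
      (by positivity) (fun x => ?_) k).trans ?_
    · rw [mul_assoc]
      exact hC.l2norm_pow_mulVec_sq_le hβ x t
    · rw [← pow_succ]
      refine (add_le_add_left (ih (t + 1)) _).trans_eq ?_
      -- The most recent noise is the term `j = 0`; the older ones are shifted by one.
      rw [Finset.sum_range_succ']
      simp only [add_comm, add_left_comm]
      ring

theorem integral_l2norm_lowerIter_le (hobs : IsIIDObservation M p b μ obs) {α : ℝ}
    (hα0 : 0 ≤ α) (hα1 : α ≤ 1) (π : S → A) (Q₀ y₀ : S × A → ℝ) {β C : ℝ} (hβ : 0 < β)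
    (hβ1 : β < 1) (hC : IsNormEquivConst (M.modeMatrix (samplingProb p b) α π) β C) (k : ℕ) :
    ∫ ω, l2norm (M.lowerIter (samplingProb p b) α π Q₀ y₀ (fun j => obs j ω) k) ∂μ
      ≤ √C * β ^ k * l2norm y₀ + α * C * √(M.noiseMax Q₀ / (1 - β ^ 2)) := by
  have hdep := M.dependsOn_lowerIter (samplingProb p b) α π Q₀ y₀ k
  have hC0 : 0 ≤ C := zero_le_one.trans hC.1
  have hW : 0 ≤ M.noiseMax Q₀ := mul_nonneg (sq_nonneg _) (sq_nonneg _)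
  have hβ2 : 0 < 1 - β ^ 2 := by nlinarith
  have hy := l2norm_nonneg y₀
  have hmom : ∫ ω, l2norm (M.lowerIter (samplingProb p b) α π Q₀ y₀ (fun j => obs j ω) k) ^ 2 ∂μ
      ≤ (√C * β ^ k * l2norm y₀) ^ 2 + (α * √C * √(M.noiseMax Q₀ / (1 - β ^ 2))) ^ 2 := by
    have h := integral_l2norm_pow_lowerIter_le hobs hα0 hα1 π Q₀ y₀ hβ hC k 0
    simp only [pow_zero, Matrix.one_mulVec, zero_add, pow_mul] at h
    refine h.trans ?_
    have hg : ∑ j ∈ Finset.range k, (β ^ 2) ^ j ≤ (1 - β ^ 2)⁻¹ := by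
      rw [← tsum_geometric_of_lt_one (sq_nonneg β) (by linarith)]
      exact (summable_geometric_of_lt_one (sq_nonneg β) (by linarith)).sum_le_tsum _
        fun j _ => by positivity
    rw [mul_pow, mul_pow, mul_pow, mul_pow, Real.sq_sqrt hC0, Real.sq_sqrt (by positivity)]
    have := mul_le_mul_of_nonneg_left hg
      (show 0 ≤ α ^ 2 * (C * M.noiseMax Q₀) by positivity)
    refine (add_le_add_right this _).trans_eq ?_
    rw [← pow_mul, ← pow_mul, mul_comm 2 k]
    ring
  refine (integral_le_sqrt_integral_sq
    (integrable_of_dependsOn (k := k) (F := fun o =>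
      l2norm (M.lowerIter (samplingProb p b) α π Q₀ y₀ o k)) hobs.measurable
      fun o o' h => congrArg l2norm (hdep h))
    (integrable_of_dependsOn (k := k) (F := fun o =>
      l2norm (M.lowerIter (samplingProb p b) α π Q₀ y₀ o k) ^ 2) hobs.measurable
      fun o o' h => congrArg (l2norm · ^ 2) (hdep h))).trans ?_
  refine (Real.sqrt_le_sqrt hmom).trans ?_
  have h1 : 0 ≤ √C * β ^ k * l2norm y₀ := by positivity
  -- The second moment gives `√C` in front of the noise floor; `C ≥ 1` weakens it to the stated `C`.
  have h2 : 0 ≤ α * √C * √(M.noiseMax Q₀ / (1 - β ^ 2)) := by positivity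
  have h3 : √C ≤ C := Real.sqrt_le_iff.2 ⟨hC0, by nlinarith [hC.1]⟩
  have h4 : α * √C * √(M.noiseMax Q₀ / (1 - β ^ 2)) ≤ α * C * √(M.noiseMax Q₀ / (1 - β ^ 2)) := by
    gcongr
  refine (Real.sqrt_le_iff.2 ⟨add_nonneg h1 h2, ?_⟩).trans (add_le_add_right h4 _)
  -- This is `a² + b² ≤ (a + b)²` for nonnegative `a`, `b`.
  nlinarith [mul_nonneg h1 h2]

end DiscountedMDP

end

/-! ### The main theorem. -/

theorem mainTheorem6 {S A Ω : Type*} [Fintype S] [Fintype A] [Nonempty S] [Nonempty A]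
    [DecidableEq S] [DecidableEq A] [MeasurableSpace S] [MeasurableSpace A]
    [MeasurableSingletonClass S] [MeasurableSingletonClass A]
    [MeasurableSpace Ω] (μ : Measure Ω) [IsProbabilityMeasure μ]
    (M : DiscountedMDP S A) (p : PMF S) (b : S → PMF A)
    (hd : ∀ x : S × A, 0 < samplingProb p b x)
    (α : ℝ) (hα0 : 0 < α) (hα1 : α < 1) (Q₀ : S × A → ℝ)
    (obs : ℕ → Ω → S × A × S) (hobs : IsIIDObservation M p b μ obs) :
    (∃ π, IsOptimizedPolicy M (samplingProb p b) α π) ∧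
    ∀ π, IsOptimizedPolicy M (samplingProb p b) α π →
      specRadius (M.modeMatrix (samplingProb p b) α π) < 1 ∧
      ∀ ε > 0, ∀ β, β = specRadius (M.modeMatrix (samplingProb p b) α π) + ε → β < 1 →
        (∃ C, IsNormEquivConst (M.modeMatrix (samplingProb p b) α π) β C) ∧
        ∀ C, IsNormEquivConst (M.modeMatrix (samplingProb p b) α π) β C →
          (∀ k, Integrable (fun ω => orthantDist M α Q₀ k fun j => obs j ω) μ ∧
            (∫ ω, orthantDist M α Q₀ k (fun j => obs j ω) ∂μ) ≤
              √C * β ^ k * l2norm (Q₀ - M.optQ)⁻ + α * C * √(M.noiseMax Q₀ / (1 - β ^ 2))) ∧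
          (fun k => max ((∫ ω, orthantDist M α Q₀ k (fun j => obs j ω) ∂μ)
              - α * C * √(M.noiseMax Q₀ / (1 - β ^ 2))) 0) =O[atTop] fun k => β ^ k := by
  have hd0 : ∀ x, 0 ≤ samplingProb p b x := samplingProb_nonneg p b
  have hd1 : ∀ x, α * samplingProb p b x ≤ 1 := fun x =>
    mul_le_one₀ hα1.le (hd0 x) (samplingProb_le_one p b x)
  refine ⟨M.exists_isOptimizedPolicy _ α, fun π hπ =>
    ⟨M.specRadius_modeMatrix_lt_one hα0 hd hd1 π, fun ε hε β hβ hβ1 => ?_⟩⟩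
  have hρβ : specRadius (M.modeMatrix (samplingProb p b) α π) < β := by linarith
  have hβ0 : 0 < β := lt_of_le_of_lt ENNReal.toReal_nonneg hρβ
  refine ⟨exists_isNormEquivConst _ hρβ, fun C hC => ?_⟩
  -- Starting the comparison system at `-e_0^-` rather than `e_0` makes only the negative part of
  -- the initial error enter the bound.
  have hy : -(Q₀ - M.optQ)⁻ ≤ Q₀ - M.optQ := neg_le.1 (neg_le_negPart _)
  have hbound : ∀ k, Integrable (fun ω => orthantDist M α Q₀ k fun j => obs j ω) μ ∧
      (∫ ω, orthantDist M α Q₀ k (fun j => obs j ω) ∂μ) ≤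
        √C * β ^ k * l2norm (Q₀ - M.optQ)⁻ + α * C * √(M.noiseMax Q₀ / (1 - β ^ 2)) := by
    intro k
    have hint : Integrable (fun ω => orthantDist M α Q₀ k fun j => obs j ω) μ :=
      integrable_of_dependsOn (k := k) hobs.measurable fun o o' h =>
        congrArg (fun Q => Metric.infDist (Q - M.optQ) {y | 0 ≤ y}) (M.dependsOn_qIter α Q₀ k h)
    refine ⟨hint, ?_⟩
    have hlow := DiscountedMDP.integral_l2norm_lowerIter_le hobs hα0.le hα1.le π Q₀
      (-(Q₀ - M.optQ)⁻) hβ0 hβ1 hC k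
    rw [l2norm_neg] at hlow
    refine (integral_mono hint ?_ fun ω =>
      M.orthantDist_le (M.lowerIter_le hα0.le hd0 hd1 hπ.1 hy (fun j => obs j ω) k)).trans hlow
    exact integrable_of_dependsOn (k := k) hobs.measurable fun o o' h =>
      congrArg l2norm (M.dependsOn_lowerIter _ α π Q₀ _ k h)
  refine ⟨hbound, IsBigO.of_bound (√C * l2norm (Q₀ - M.optQ)⁻) (Eventually.of_forall fun k => ?_)⟩
  have hn := l2norm_nonneg (Q₀ - M.optQ)⁻
  rw [Real.norm_of_nonneg (le_max_right _ _), Real.norm_of_nonneg (by positivity)]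
  refine max_le ?_ (by positivity)
  linarith [(hbound k).2]
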